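/- Let $G$ be a group with a finite generating set $S$ whose Cayley graph $X$ (with edges joining $g$ and $gs$ for $g\in G$, $s\in S$, metrized so that each edge is isometric to $[0,1]$ and the metric restricts to the word metric on $G$) is Gromov hyperbolic, i.e. there is $\delta$ with $(x|z)_o\ge\min\{(x|y)_o,(y|z)_o\}-\delta$ for all $x,y,z,o\in X$, where $(x|y)_o=\frac12\big(d(o,x)+d(o,y)-d(x,y)\big)$. Fix $o\in X$. Let $\partial G$ be the set of geodesic rays $[0,\infty)\to X$ modulo bounded distance, and for $\xi,\eta\in\partial G$ let $(\xi|\eta)\in[0,\infty]$ be the infimum of $\liminf_n (x_n|y_n)_o$ over all sequences $x_n\to\xi$, $y_n\to\eta$ in $X$; here $x_n\to\xi$ means that $(x_n|\sigma(t))_o\to\infty$ as $n,t\to\infty$, for a ray $\sigma$ in the class $\xi$. For $a>1$, call a metric $d_a$ on $\partial G$ visual with parameter $a$ if there is $\lambda>0$ such that $\lambda^{-1}a^{-(\xi|\eta)}\le d_a(\xi,\eta)\le\lambda a^{-(\xi|\eta)}$ for all $\xi,\eta\in\partial G$ (with $a^{-\infty}=0$). Theorem. There is $a_0>1$ such that visual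 metrics with parameter $a$ exist on $\partial G$ for every $a\in(1,a_0)$; and for every $a>1$ and every visual metric $d_a$ on $\partial G$ with parameter $a$, the metric space $(\partial G,d_a)$ has finite multiplicity: there are an integer $K>0$ and $\epsilon_0>0$ such that for every $\epsilon\in(0,\epsilon_0)$ there is a set $A\subset\partial G$ for which the open balls $B(c,\epsilon)$, $c\in A$, cover $\partial G$ and every point of $\partial G$ lies in $B(c,\epsilon)$ for at most $K$ points $c\in A$. -/

import Mathlib

open Filter Topology
open scoped ENNReal

/-! ### The geometric realization of a connected graph, with its length metric -/

namespace MetricGraph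

variable {V : Type*}

/-- The segment joining the vertices `u` and `v`, inside the space of finitely supported
functions on the vertices; the coordinates are barycentric coordinates. -/
def edge (u v : V) : Set (V →₀ ℝ) :=
  segment ℝ (Finsupp.single u 1) (Finsupp.single v 1)

/-- `edge u v` is a cell of the realization of `Γ` if it is a single vertex (`u = v`) or if
`u` and `v` are joined by an edge of `Γ`. -/
def IsCell (Γ : SimpleGraph V) (u v : V) : Prop := u = v ∨ Γ.Adj u v

/-- The length of the path between two points of one and the same cell which stays in the cell. -/
def InnerLength (Γ : SimpleGraph V) (x y : V →₀ ℝ) (r : ℝ) : Prop :=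
  ∃ u v, IsCell Γ u v ∧ x ∈ edge u v ∧ y ∈ edge u v ∧ r = |x u - y u|

/-- The length of a path from `x` to `y` which runs from `x` straight to an end point `a` of a
cell of `x`, then along a shortest edge path to an end point `b` of a cell of `y`, then straight
to `y`. (The point `x` is at distance `1 - x a` from `a` in the edge.) -/
def OuterLength (Γ : SimpleGraph V) (x y : V →₀ ℝ) (r : ℝ) : Prop :=
  ∃ a b, x a ≠ 0 ∧ y b ≠ 0 ∧ r = (1 - x a) + Γ.dist a b + (1 - y b)

end MetricGraph

open MetricGraph in
/-- The geometric realization of a connected graph: the union of the segments spanned by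
its vertices and edges. -/
def MetricGraph {V : Type*} (Γ : SimpleGraph V) (_ : Γ.Connected) : Type _ :=
  {x : V →₀ ℝ // ∃ u v, IsCell Γ u v ∧ x ∈ edge u v}

namespace MetricGraph

variable {V : Type*} {Γ : SimpleGraph V}

/-- The length metric for which every edge is isometric to `[0, 1]`. -/
noncomputable instance (hΓ : Γ.Connected) : Dist (MetricGraph Γ hΓ) where
  dist x y := sInf {r | InnerLength Γ x.1 y.1 r ∨ OuterLength Γ x.1 y.1 r}

lemma edge_cases {u v : V} {x : V →₀ ℝ} (hx : x ∈ edge u v) :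
    (∀ w, 0 ≤ x w ∧ x w ≤ 1) ∧ (∀ w, x w ≠ 0 → w = u ∨ w = v) ∧
      (u = v → x = Finsupp.single u 1) ∧ (u ≠ v → x u + x v = 1) := by
  classical
  obtain ⟨s, t, hs, ht, hst, rfl⟩ := hx
  refine ⟨fun w => ?_, fun w => ?_, ?_, ?_⟩
  · simp only [Finsupp.coe_add, Finsupp.coe_smul, Pi.add_apply, Pi.smul_apply,
      Finsupp.single_apply, smul_eq_mul]
    split_ifs <;> constructor <;> linarith
  · contrapose!
    rintro ⟨h1, h2⟩
    simp [h1.symm, h2.symm]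
  · rintro rfl
    rw [← add_smul, hst, one_smul]
  · intro h
    simp [h, h.symm, hst]

lemma eq_single {u v w : V} {x : V →₀ ℝ} (hx : x ∈ edge u v) (hw : x w = 1) :
    x = Finsupp.single w 1 := by
  classical
  obtain ⟨h0, h1, h2, h3⟩ := edge_cases hx
  by_cases huv : u = v
  · have := h2 huv
    rcases h1 w (by simp [hw]) with rfl | rfl
    · exact this
    · rw [this, huv]
  · have h3 := h3 huv
    have key : ∀ z, z ≠ w → x z = 0 := by
      intro z hz
      by_contra hne
      rcases h1 w (by simp [hw]) with rfl | rfl <;> rcases h1 z hne with rfl | rfl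
      · exact hz rfl
      · exact hne (by linarith)
      · exact hne (by linarith)
      · exact hz rfl
    ext z
    by_cases hz : z = w
    · subst hz; simp [hw]
    · rw [key z hz, Finsupp.single_apply, if_neg (Ne.symm hz)]

lemma dist_le_of_ne_zero {u v : V} (huv : IsCell Γ u v) {x : V →₀ ℝ} (hx : x ∈ edge u v)
    {a b : V} (ha : x a ≠ 0) (hb : x b ≠ 0) :
    (Γ.dist a b : ℝ) ≤ (1 - x a) + (1 - x b) := by
  obtain ⟨h0, h1, h2, h3⟩ := edge_cases hx
  have hA := (h0 a).2
  have hB := (h0 b).2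
  by_cases hab : a = b
  · subst hab; simp; linarith
  · rcases h1 a ha with rfl | rfl <;> rcases h1 b hb with rfl | rfl
    · exact absurd rfl hab
    · have := h3 hab
      rw [SimpleGraph.dist_eq_one_iff_adj.2 (huv.resolve_left hab)]
      push_cast; linarith
    · have := h3 (Ne.symm hab)
      rw [SimpleGraph.dist_eq_one_iff_adj.2 (huv.resolve_left (Ne.symm hab)).symm]
      push_cast; linarith
    · exact absurd rfl hab

lemma abs_sub_eq {u v : V} {x y : V →₀ ℝ} (hx : x ∈ edge u v) (hy : y ∈ edge u v)
    {b : V} (hb : b = u ∨ b = v) : |x u - y u| = |x b - y b| := by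
  rcases hb with rfl | rfl
  · rfl
  · by_cases h : u = b
    · rw [h]
    · have h1 := (edge_cases hx).2.2.2 h
      have h2 := (edge_cases hy).2.2.2 h
      rw [show x u - y u = -(x b - y b) by linarith, abs_neg]

lemma InnerLength.symm {x y : V →₀ ℝ} {r : ℝ} (h : InnerLength Γ x y r) :
    InnerLength Γ y x r := by
  obtain ⟨u, v, h, hx, hy, rfl⟩ := h
  exact ⟨u, v, h, hy, hx, abs_sub_comm _ _⟩

lemma OuterLength.symm {x y : V →₀ ℝ} {r : ℝ} (h : OuterLength Γ x y r) :
    OuterLength Γ y x r := by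
  obtain ⟨a, b, ha, hb, rfl⟩ := h
  exact ⟨b, a, hb, ha, by rw [SimpleGraph.dist_comm]; ring⟩

lemma inner_outer (hΓ : Γ.Connected) {x y z : V →₀ ℝ} {r s : ℝ} (h : InnerLength Γ x y r)
    (h' : OuterLength Γ y z s) : ∃ t, OuterLength Γ x z t ∧ t ≤ r + s := by
  obtain ⟨u, v, huv, hx, hy, rfl⟩ := h
  obtain ⟨b, c, hb, hc, rfl⟩ := h'
  obtain ⟨h0, h1, h2, h3⟩ := edge_cases hx
  have hbuv := (edge_cases hy).2.1 b hb
  rw [abs_sub_eq hx hy hbuv]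
  by_cases hxb : x b = 0
  · have hne : u ≠ v := by
      intro h
      have := h2 h
      have hbu : b = u := by rcases hbuv with rfl | rfl <;> simp [h]
      rw [this, hbu] at hxb
      simp at hxb
    have h3 := h3 hne
    obtain ⟨w, hw, hwb⟩ : ∃ w, x w = 1 ∧ Γ.Adj w b := by
      rcases hbuv with rfl | rfl
      · exact ⟨v, by linarith, (huv.resolve_left hne).symm⟩
      · exact ⟨u, by linarith, huv.resolve_left hne⟩
    refine ⟨_, ⟨w, c, by simp [hw], hc, rfl⟩, ?_⟩
    have ht : (Γ.dist w c : ℝ) ≤ Γ.dist w b + Γ.dist b c := by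
      exact_mod_cast hΓ.dist_triangle
    rw [SimpleGraph.dist_eq_one_iff_adj.2 hwb] at ht
    push_cast at ht
    have := neg_abs_le (x b - y b)
    rw [hw]
    rw [hxb] at this ⊢
    linarith
  · refine ⟨_, ⟨b, c, hxb, hc, rfl⟩, ?_⟩
    have := neg_abs_le (x b - y b)
    linarith

lemma inner_of_vertex {x y : V →₀ ℝ} {r : ℝ} {w : V} (h : InnerLength Γ x y r) (hw : y w = 1) :
    ∃ t, OuterLength Γ x y t ∧ t ≤ r := by
  obtain ⟨u, v, huv, hx, hy, rfl⟩ := h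
  obtain ⟨h0, h1, h2, h3⟩ := edge_cases hx
  have hwuv := (edge_cases hy).2.1 w (by simp [hw])
  rw [abs_sub_eq hx hy hwuv]
  have habs := neg_abs_le (x w - y w)
  by_cases hxw : x w = 0
  · have hne : u ≠ v := by
      intro h
      have := h2 h
      have hbu : w = u := by rcases hwuv with rfl | rfl <;> simp [h]
      rw [this, hbu] at hxw
      simp at hxw
    have h3 := h3 hne
    obtain ⟨w', hw', hadj⟩ : ∃ w', x w' = 1 ∧ Γ.Adj w' w := by
      rcases hwuv with rfl | rfl
      · exact ⟨v, by linarith, (huv.resolve_left hne).symm⟩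
      · exact ⟨u, by linarith, huv.resolve_left hne⟩
    refine ⟨_, ⟨w', w, by simp [hw'], by simp [hw], rfl⟩, ?_⟩
    rw [SimpleGraph.dist_eq_one_iff_adj.2 hadj, hw']
    push_cast
    linarith
  · refine ⟨_, ⟨w, w, hxw, by simp [hw], rfl⟩, ?_⟩
    rw [SimpleGraph.dist_self]
    push_cast
    linarith

lemma length_triangle (hΓ : Γ.Connected) (x y z : MetricGraph Γ hΓ) {r s : ℝ}
    (h : InnerLength Γ x.1 y.1 r ∨ OuterLength Γ x.1 y.1 r)
    (h' : InnerLength Γ y.1 z.1 s ∨ OuterLength Γ y.1 z.1 s) :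
    ∃ t, (InnerLength Γ x.1 z.1 t ∨ OuterLength Γ x.1 z.1 t) ∧ t ≤ r + s := by
  rcases h with h | h <;> rcases h' with h' | h'
  · by_cases hy : ∃ w, y.1 w = 1
    · obtain ⟨w, hw⟩ := hy
      obtain ⟨t, ht, htr⟩ := inner_of_vertex h hw
      obtain ⟨t', ht', htr'⟩ := inner_outer hΓ h'.symm ht.symm
      exact ⟨t', Or.inr ht'.symm, by linarith⟩
    · obtain ⟨u, v, huv, hx, hyu, rfl⟩ := h
      obtain ⟨u', v', huv', hyu', hz, rfl⟩ := h'
      push Not at hy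
      obtain ⟨-, h1, h2, h3⟩ := edge_cases hyu
      obtain ⟨-, h1', h2', h3'⟩ := edge_cases hyu'
      have hne : u ≠ v := fun h => hy u (by rw [h2 h]; simp)
      have h3 := h3 hne
      have hu : y.1 u ≠ 0 := fun h => hy v (by linarith)
      have hv : y.1 v ≠ 0 := fun h => hy u (by linarith)
      have hz' : z.1 ∈ edge u v := by
        rcases h1' u hu with rfl | rfl <;> rcases h1' v hv with rfl | rfl
        · exact absurd rfl hne
        · exact hz
        · rw [edge, segment_symm]; exact hz
        · exact absurd rfl hne
      refine ⟨_, Or.inl ⟨u, v, huv, hx, hz', rfl⟩, ?_⟩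
      rw [abs_sub_eq hyu' hz (h1' u hu)]
      exact abs_sub_le _ _ _
  · obtain ⟨t, ht, htr⟩ := inner_outer hΓ h h'
    exact ⟨t, Or.inr ht, htr⟩
  · obtain ⟨t, ht, htr⟩ := inner_outer hΓ h'.symm h.symm
    exact ⟨t, Or.inr ht.symm, by linarith⟩
  · obtain ⟨a, b, ha, hb, rfl⟩ := h
    obtain ⟨b', c, hb', hc, rfl⟩ := h'
    refine ⟨_, Or.inr ⟨a, c, ha, hc, rfl⟩, ?_⟩
    obtain ⟨u, v, huv, hyu⟩ := y.2
    have h1 := dist_le_of_ne_zero huv hyu hb hb'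
    have h2 : (Γ.dist a c : ℝ) ≤ Γ.dist a b + (Γ.dist b b' + Γ.dist b' c) := by
      exact_mod_cast (hΓ.dist_triangle (v := b)).trans
        (Nat.add_le_add_left (hΓ.dist_triangle (v := b')) _)
    linarith

lemma length_nonneg {hΓ : Γ.Connected} (x y : MetricGraph Γ hΓ) {r : ℝ}
    (h : InnerLength Γ x.1 y.1 r ∨ OuterLength Γ x.1 y.1 r) : 0 ≤ r := by
  rcases h with ⟨u, v, -, -, -, rfl⟩ | ⟨a, b, -, -, rfl⟩
  · exact abs_nonneg _
  · obtain ⟨u, v, -, hx⟩ := x.2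
    obtain ⟨u', v', -, hy⟩ := y.2
    have := ((edge_cases hx).1 a).2
    have := ((edge_cases hy).1 b).2
    have : (0 : ℝ) ≤ Γ.dist a b := Nat.cast_nonneg _
    linarith

lemma exists_ne_zero {hΓ : Γ.Connected} (x : MetricGraph Γ hΓ) : ∃ a, x.1 a ≠ 0 := by
  obtain ⟨u, v, -, hx⟩ := x.2
  obtain ⟨-, -, h2, h3⟩ := edge_cases hx
  by_contra! h
  by_cases huv : u = v
  · have := h u
    rw [h2 huv] at this
    simp at this
  · have := h3 huv
    rw [h u, h v] at this
    norm_num at this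

lemma dist_mem {hΓ : Γ.Connected} (x y : MetricGraph Γ hΓ) :
    InnerLength Γ x.1 y.1 (dist x y) ∨ OuterLength Γ x.1 y.1 (dist x y) := by
  classical
  have hfin : {r | InnerLength Γ x.1 y.1 r ∨ OuterLength Γ x.1 y.1 r}.Finite := by
    refine Set.Finite.subset (((x.1 - y.1).finite_range.image abs).union
      ((x.1.support ×ˢ y.1.support).finite_toSet.image
        (fun p => (1 - x.1 p.1) + (Γ.dist p.1 p.2 : ℝ) + (1 - y.1 p.2)))) ?_
    rintro r (⟨u, v, -, -, -, rfl⟩ | ⟨a, b, ha, hb, rfl⟩)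
    · exact Or.inl ⟨_, ⟨u, rfl⟩, by simp⟩
    · exact Or.inr ⟨(a, b), by simp [ha, hb], rfl⟩
  have hne : {r | InnerLength Γ x.1 y.1 r ∨ OuterLength Γ x.1 y.1 r}.Nonempty := by
    obtain ⟨a, ha⟩ := exists_ne_zero x
    obtain ⟨b, hb⟩ := exists_ne_zero y
    exact ⟨_, Or.inr ⟨a, b, ha, hb, rfl⟩⟩
  exact hne.csInf_mem hfin

lemma dist_le_length {hΓ : Γ.Connected} (x y : MetricGraph Γ hΓ) {r : ℝ}
    (h : InnerLength Γ x.1 y.1 r ∨ OuterLength Γ x.1 y.1 r) : dist x y ≤ r :=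
  csInf_le ⟨0, fun _ hs => length_nonneg x y hs⟩ h

noncomputable instance (hΓ : Γ.Connected) : MetricSpace (MetricGraph Γ hΓ) where
  dist_self x := by
    refine le_antisymm ?_ (length_nonneg x x (dist_mem x x))
    obtain ⟨u, v, huv, hx⟩ := x.2
    exact dist_le_length x x (Or.inl ⟨u, v, huv, hx, hx, by simp⟩)
  dist_comm x y :=
    le_antisymm (dist_le_length x y ((dist_mem y x).imp .symm .symm))
      (dist_le_length y x ((dist_mem x y).imp .symm .symm))
  dist_triangle x y z := by
    obtain ⟨t, ht, hle⟩ := length_triangle hΓ x y z (dist_mem x y) (dist_mem y z)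
    exact (dist_le_length x z ht).trans hle
  eq_of_dist_eq_zero {x y} h := by
    have hm := dist_mem x y
    rw [h] at hm
    apply Subtype.ext
    rcases hm with ⟨u, v, huv, hx, hy, h0⟩ | ⟨a, b, ha, hb, h0⟩
    · have hu := sub_eq_zero.1 (abs_eq_zero.1 h0.symm)
      obtain ⟨-, h1, h2, h3⟩ := edge_cases hx
      obtain ⟨-, h1', h2', h3'⟩ := edge_cases hy
      by_cases h : u = v
      · rw [h2 h, h2' h]
      · have h3 := h3 h
        have h3' := h3' h
        ext w
        by_cases hwu : w = u
        · rw [hwu, hu]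
        by_cases hwv : w = v
        · rw [hwv]; linarith
        rw [not_imp_comm.1 (h1 w) (by tauto), not_imp_comm.1 (h1' w) (by tauto)]
    · obtain ⟨u, v, -, hx⟩ := x.2
      obtain ⟨u', v', -, hy⟩ := y.2
      have h1 := ((edge_cases hx).1 a).2
      have h2 := ((edge_cases hy).1 b).2
      have h3 : (0 : ℝ) ≤ Γ.dist a b := Nat.cast_nonneg _
      have h4 : Γ.dist a b = 0 := by
        have : (Γ.dist a b : ℝ) = 0 := by linarith
        exact_mod_cast this
      have hab : a = b := hΓ.dist_eq_zero_iff.1 h4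
      rw [eq_single hx (w := a) (by linarith), eq_single hy (w := b) (by linarith), hab]

end MetricGraph

/-! ### Cayley graphs -/

/-- The graph with an edge between `g` and `g * s` for `g` in the group and `s` in `S` is
connected if `S` generates the group. -/
lemma mulCayley_connected {G : Type*} [Group G] {S : Set G} (hS : Subgroup.closure S = ⊤) :
    (SimpleGraph.mulCayley S).Connected := by
  have step : ∀ g s : G, s ∈ S → (SimpleGraph.mulCayley S).Reachable g (g * s) := by
    intro g s hs
    by_cases h : g = g * s
    · rw [← h]
    · exact SimpleGraph.Adj.reachable ((SimpleGraph.mulCayley_adj S _ _).2 ⟨h, Or.inl (by simpa)⟩)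
  have key : ∀ h : G, h ∈ Subgroup.closure S →
      ∀ g, (SimpleGraph.mulCayley S).Reachable g (g * h) := by
    intro h hh
    induction hh using Subgroup.closure_induction with
    | mem s hs => exact fun g => step g s hs
    | one => intro g; simp
    | mul x y _ _ hx hy => intro g; rw [← mul_assoc]; exact (hx g).trans (hy _)
    | inv x _ hx => intro g; simpa using (hx (g * x⁻¹)).symm
  have : Nonempty G := ⟨1⟩
  refine ⟨fun g h => ?_⟩
  have := key (g⁻¹ * h) (by rw [hS]; trivial) g
  simpa using this

/-- The Cayley graph of `G` with respect to the generating set `S`, as a metric space: it induces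
the word metric on `G`, and every edge is isometric to `[0, 1]`. -/
abbrev CayleyGraph {G : Type*} [Group G] (S : Set G) (hS : Subgroup.closure S = ⊤) : Type _ :=
  MetricGraph (SimpleGraph.mulCayley S) (mulCayley_connected hS)

/-! ### Hyperbolic spaces and their boundary -/

section Hyperbolic

variable {X : Type*} [MetricSpace X]

/-- The Gromov product of `x` and `y` with respect to `o`. -/
noncomputable def gromovProduct (o x y : X) : ℝ := (dist o x + dist o y - dist x y) / 2

variable (X) in
/-- Gromov hyperbolicity. -/
def IsGromovHyperbolic : Prop :=
  ∃ δ : ℝ, ∀ x y z o : X,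
    min (gromovProduct o x y) (gromovProduct o y z) - δ ≤ gromovProduct o x z

variable (X) in
/-- Geodesic rays: isometries from `[0, ∞)` to `X`. -/
def GeodesicRay : Type _ := {σ : Set.Ici (0 : ℝ) → X // Isometry σ}

variable (X) in
/-- Two geodesic rays are equivalent if they stay at bounded distance from each other. -/
def raySetoid : Setoid (GeodesicRay X) where
  r σ τ := ∃ D : ℝ, ∀ t, dist (σ.1 t) (τ.1 t) ≤ D
  iseqv :=
    { refl := fun _ => ⟨0, fun _ => by simp⟩
      symm := fun ⟨D, h⟩ => ⟨D, fun t => by rw [dist_comm]; exact h t⟩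
      trans := fun ⟨D, h⟩ ⟨D', h'⟩ =>
        ⟨D + D', fun t => (dist_triangle _ _ _).trans (add_le_add (h t) (h' t))⟩ }

variable (X) in
/-- The hyperbolic boundary: geodesic rays up to equivalence. -/
def HyperbolicBoundary : Type _ := Quotient (raySetoid X)

/-- A sequence `x` in `X` converges to the boundary point `ξ`: the Gromov products `(x n | σ t)`
tend to infinity with `n` and `t`, where `σ` is a geodesic ray in the class `ξ`. -/
def ConvergesToBoundary (o : X) (x : ℕ → X) (ξ : HyperbolicBoundary X) : Prop :=
  ∃ σ : GeodesicRay X, Quotient.mk (raySetoid X) σ = ξ ∧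
    Tendsto (fun p : ℕ × Set.Ici (0 : ℝ) => gromovProduct o (x p.1) (σ.1 p.2)) atTop atTop

/-- The Gromov product of two boundary points, with values in `[0, ∞]`: the smallest value of
`liminf (x n | y n)` over the sequences `x`, `y` in `X` which converge to `ξ`, `η`. -/
noncomputable def boundaryProduct (o : X) (ξ η : HyperbolicBoundary X) : ℝ≥0∞ :=
  ⨅ (x : ℕ → X) (y : ℕ → X) (_ : ConvergesToBoundary o x ξ) (_ : ConvergesToBoundary o y η),
    liminf (fun n => ENNReal.ofReal (gromovProduct o (x n) (y n))) atTop

open Classical in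
/-- The quantity `a ^ (-(ξ|η))`, which is `0` if `(ξ|η) = ∞`. -/
noncomputable def visualKernel (o : X) (a : ℝ) (ξ η : HyperbolicBoundary X) : ℝ :=
  if boundaryProduct o ξ η = ⊤ then 0 else a ^ (-(boundaryProduct o ξ η).toReal)

/-- A metric on the boundary is visual with parameter `a` if it agrees with `a ^ (-(ξ|η))` up to
a multiplicative constant. -/
def IsVisualMetric (o : X) (a : ℝ) (d : MetricSpace (HyperbolicBoundary X)) : Prop :=
  ∃ C : ℝ, 0 < C ∧ ∀ ξ η : HyperbolicBoundary X,
    C⁻¹ * visualKernel o a ξ η ≤ d.dist ξ η ∧ d.dist ξ η ≤ C * visualKernel o a ξ η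

end Hyperbolic

/-- Finite multiplicity: there is a bound `K` such that for every small `ε` the space is covered
by balls of radius `ε` in such a way that every point lies in at most `K` of the balls. The balls
are counted by their centres. -/
def HasFiniteMultiplicity {Y : Type*} (d : MetricSpace Y) : Prop :=
  ∃ K : ℕ, 0 < K ∧ ∃ ε₀ : ℝ, 0 < ε₀ ∧ ∀ ε : ℝ, 0 < ε → ε < ε₀ →
    ∃ A : Set Y, (⋃ c ∈ A, Metric.ball c ε) = Set.univ ∧
      ∀ y : Y, {c ∈ A | y ∈ Metric.ball c ε}.encard ≤ K

/-! ### Gromov products and geodesic rays -/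

section Hyperbolic

variable {X : Type*} [MetricSpace X]

/-! Existence: hyperbolicity passes to the boundary (`boundaryProduct_le_add`), so `a ^ (-(ξ|η))`
satisfies the ultrametric inequality up to the factor `a ^ δ`. When `a ^ (2 * δ) ≤ 2`, Frink's chain
construction turns such a kernel into a metric, losing at most a factor 2.

Finite multiplicity: the balls are centred at a maximal `ε`-separated set. In logarithmic scale, the
centres `ξ` of the balls containing `η` satisfy `(ξ|η) > R` and, pairwise, `(ξ|ξ') < R + L`, where
`L` depends only on the visual constant and `a`. Thus, seen from `o`, their rays stay together up to
height about `R` and have separated by height about `R + L`. Choosing for each centre a vertex near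
its ray at a height `T` slightly above `R + L` gives distinct vertices at mutual distance bounded
independently of `ε` (`card_le_of_boundaryProduct_bounds`). A Cayley graph is homogeneous and
locally finite, so the number of such vertices is bounded uniformly in `R` and `η`. -/

lemma gromovProduct_comm (o x y : X) : gromovProduct o x y = gromovProduct o y x := by
  simp only [gromovProduct, dist_comm x y]; ring

lemma gromovProduct_le_add_dist (o x y z : X) :
    gromovProduct o x y ≤ gromovProduct o x z + dist y z := by
  have h1 := dist_triangle o z y
  have h2 := dist_triangle x y z
  rw [dist_comm z y] at h1
  simp only [gromovProduct]
  linarith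

variable (X) in
/-- Gromov hyperbolicity with a given constant. -/
def HyperbolicWith (δ : ℝ) : Prop :=
  ∀ x y z o : X, min (gromovProduct o x y) (gromovProduct o y z) - δ ≤ gromovProduct o x z

lemma IsGromovHyperbolic.exists_nonneg (h : IsGromovHyperbolic X) :
    ∃ δ, 0 ≤ δ ∧ HyperbolicWith X δ := by
  obtain ⟨δ, hδ⟩ := h
  exact ⟨max δ 0, le_max_right _ _, fun x y z o =>
    (sub_le_sub_left (le_max_left δ 0) _).trans (hδ x y z o)⟩

lemma HyperbolicWith.le_of_le {δ : ℝ} (h : HyperbolicWith X δ) {o x y z : X} {r : ℝ}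
    (h1 : r ≤ gromovProduct o x y) (h2 : r ≤ gromovProduct o y z) :
    r - δ ≤ gromovProduct o x z :=
  (sub_le_sub_right (le_min h1 h2) δ).trans (h x y z o)

namespace GeodesicRay

/-- The point of a geodesic ray at an integer time. -/
def point (σ : GeodesicRay X) (n : ℕ) : X := σ.1 ⟨n, Set.mem_Ici.2 (Nat.cast_nonneg _)⟩

lemma dist_eq (σ : GeodesicRay X) (s t : Set.Ici (0 : ℝ)) :
    dist (σ.1 s) (σ.1 t) = |(s : ℝ) - t| := by
  rw [σ.2.dist_eq, Subtype.dist_eq, Real.dist_eq]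

lemma sub_le_dist (σ : GeodesicRay X) (o : X) (t : Set.Ici (0 : ℝ)) :
    (t : ℝ) - dist o (σ.1 ⟨0, Set.mem_Ici.2 le_rfl⟩) ≤ dist o (σ.1 t) := by
  have h := dist_triangle_left (σ.1 ⟨0, Set.mem_Ici.2 le_rfl⟩) (σ.1 t) o
  rw [σ.dist_eq] at h
  have := neg_abs_le ((0 : ℝ) - t)
  simp only at h
  linarith

lemma dist_le_add (σ : GeodesicRay X) (o : X) (t : Set.Ici (0 : ℝ)) :
    dist o (σ.1 t) ≤ t + dist o (σ.1 ⟨0, Set.mem_Ici.2 le_rfl⟩) := by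
  have h := dist_triangle o (σ.1 ⟨0, Set.mem_Ici.2 le_rfl⟩) (σ.1 t)
  rw [σ.dist_eq] at h
  have h0 : (0 : ℝ) ≤ t := t.2
  have : |(0 : ℝ) - t| = t := by rw [zero_sub, abs_neg, abs_of_nonneg h0]
  simp only [this] at h
  linarith

/-- Seen from the start of the ray the product is exactly `min s t`; rays need not start at `o`,
which costs the distance from `o` to the start. -/
lemma min_sub_le_gromovProduct (σ : GeodesicRay X) (o : X) (s t : Set.Ici (0 : ℝ)) :
    min (s : ℝ) t - dist o (σ.1 ⟨0, Set.mem_Ici.2 le_rfl⟩) ≤ gromovProduct o (σ.1 s) (σ.1 t) := by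
  have h1 := σ.sub_le_dist o s
  have h2 := σ.sub_le_dist o t
  have h3 : 2 * min (s : ℝ) t = s + t - |(s : ℝ) - t| := by
    rcases le_total (s : ℝ) t with h | h
    · rw [min_eq_left h, abs_of_nonpos (by linarith)]; ring
    · rw [min_eq_right h, abs_of_nonneg (by linarith)]; ring
  rw [gromovProduct, σ.dist_eq]
  linarith

/-- The boundary point represented by a geodesic ray. -/
def endpoint (σ : GeodesicRay X) : HyperbolicBoundary X := Quotient.mk (raySetoid X) σ

lemma exists_endpoint_eq (ξ : HyperbolicBoundary X) : ∃ σ : GeodesicRay X, σ.endpoint = ξ :=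
  Quotient.exists_rep ξ

lemma convergesToBoundary (σ : GeodesicRay X) (o : X) :
    ConvergesToBoundary o σ.point σ.endpoint := by
  refine ⟨σ, rfl, tendsto_atTop.2 fun b => ?_⟩
  rw [← prod_atTop_atTop_eq]
  set c := dist o (σ.1 ⟨0, Set.mem_Ici.2 le_rfl⟩)
  obtain ⟨N, hN⟩ := exists_nat_ge (b + c)
  filter_upwards [prod_mem_prod (Ici_mem_atTop N)
    (Ici_mem_atTop (⟨N, Set.mem_Ici.2 (Nat.cast_nonneg _)⟩ : Set.Ici (0 : ℝ)))] with p hp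
  have h1 : (N : ℝ) ≤ p.1 := Nat.cast_le.2 hp.1
  have h2 : (N : ℝ) ≤ p.2 := hp.2
  have h3 := σ.min_sub_le_gromovProduct o ⟨p.1, Set.mem_Ici.2 (Nat.cast_nonneg _)⟩ p.2
  have h4 : (N : ℝ) ≤ min (p.1 : ℝ) p.2 := le_min h1 h2
  simp only [point] at h3 ⊢
  linarith

/-- Convergence is defined through some ray of the class. An equivalent ray stays within `D`, which
changes Gromov products by at most `D`, so any representative can serve as a test ray. -/
lemma exists_le_gromovProduct {σ : GeodesicRay X} {o : X} {x : ℕ → X}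
    (h : ConvergesToBoundary o x σ.endpoint) (b : ℝ) :
    ∃ N : ℕ, ∀ n ≥ N, ∀ m ≥ N, b ≤ gromovProduct o (x n) (σ.point m) := by
  obtain ⟨τ, hτ, ht⟩ := h
  obtain ⟨D, hD⟩ : ∃ D : ℝ, ∀ t, dist (τ.1 t) (σ.1 t) ≤ D := Quotient.exact hτ
  have h1 := tendsto_atTop.1 ht (b + D)
  rw [eventually_atTop] at h1
  obtain ⟨⟨N, T⟩, h2⟩ := h1
  obtain ⟨M, hM⟩ := exists_nat_ge (T : ℝ)
  refine ⟨max N M, fun n hn m hm => ?_⟩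
  have hTm : (T : ℝ) ≤ m := hM.trans (Nat.cast_le.2 ((le_max_right _ _).trans hm))
  have h3 := h2 (n, ⟨m, Set.mem_Ici.2 (Nat.cast_nonneg _)⟩) ⟨(le_max_left _ _).trans hn, hTm⟩
  have h4 := gromovProduct_le_add_dist o (x n) (τ.1 ⟨m, Set.mem_Ici.2 (Nat.cast_nonneg _)⟩) (σ.point m)
  have h5 := hD ⟨m, Set.mem_Ici.2 (Nat.cast_nonneg _)⟩
  simp only [point] at h3 h4 ⊢
  linarith

end GeodesicRay

/-! ### The Gromov product on the boundary -/

lemma lt_gromovProduct_of_lt_boundaryProduct {o : X} {ξ η : HyperbolicBoundary X} {x y : ℕ → X}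
    (hx : ConvergesToBoundary o x ξ) (hy : ConvergesToBoundary o y η) {r : ℝ}
    (h : ENNReal.ofReal r < boundaryProduct o ξ η) :
    ∀ᶠ n in atTop, r < gromovProduct o (x n) (y n) := by
  have h1 : boundaryProduct o ξ η ≤
      liminf (fun n => ENNReal.ofReal (gromovProduct o (x n) (y n))) atTop :=
    iInf_le_of_le x <| iInf_le_of_le y <| iInf_le_of_le hx <| iInf_le _ hy
  filter_upwards [eventually_lt_of_lt_liminf (h.trans_le h1)] with n hn
  exact (ENNReal.ofReal_lt_ofReal_iff'.1 hn).1

lemma le_boundaryProduct {o : X} {ξ η : HyperbolicBoundary X} {p : ℝ≥0∞}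
    (h : ∀ x y : ℕ → X, ConvergesToBoundary o x ξ → ConvergesToBoundary o y η → ∀ r : ℝ, 0 ≤ r →
      ENNReal.ofReal r < p → ∀ᶠ n in atTop, r ≤ gromovProduct o (x n) (y n)) :
    p ≤ boundaryProduct o ξ η := by
  refine le_iInf fun x => le_iInf fun y => le_iInf fun hx => le_iInf fun hy => ?_
  refine le_of_forall_lt fun q hq => ?_
  obtain ⟨q', hqq', hq'⟩ := exists_between hq
  have hne : q' ≠ ⊤ := hq'.ne_top
  -- The intermediate `q'` is finite, hence a real bound, and leaves room for the strict inequality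
  -- with `q`.
  refine hqq'.trans_le (le_liminf_of_le (by isBoundedDefault) ?_)
  filter_upwards [h x y hx hy q'.toReal ENNReal.toReal_nonneg
    (by rwa [ENNReal.ofReal_toReal hne])] with n hn
  rw [← ENNReal.ofReal_toReal hne]
  exact ENNReal.ofReal_le_ofReal hn

lemma boundaryProduct_comm (o : X) (ξ η : HyperbolicBoundary X) :
    boundaryProduct o ξ η = boundaryProduct o η ξ := by
  have key : ∀ ξ η : HyperbolicBoundary X, boundaryProduct o ξ η ≤ boundaryProduct o η ξ := by
    intro ξ η
    refine le_boundaryProduct fun x y hx hy r hr h => ?_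
    filter_upwards [lt_gromovProduct_of_lt_boundaryProduct hy hx h] with n hn
    rw [gromovProduct_comm]
    exact hn.le
  exact le_antisymm (key ξ η) (key η ξ)

lemma boundaryProduct_self {δ : ℝ} (hδ : HyperbolicWith X δ) (o : X)
    (ξ : HyperbolicBoundary X) : boundaryProduct o ξ ξ = ⊤ := by
  obtain ⟨σ, rfl⟩ := GeodesicRay.exists_endpoint_eq ξ
  refine top_le_iff.1 (le_boundaryProduct fun x y hx hy r _ _ => ?_)
  obtain ⟨N, hN⟩ := GeodesicRay.exists_le_gromovProduct hx (r + δ)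
  obtain ⟨M, hM⟩ := GeodesicRay.exists_le_gromovProduct hy (r + δ)
  filter_upwards [eventually_ge_atTop (max N M)] with n hn
  have h1 := hN n ((le_max_left _ _).trans hn) n ((le_max_left _ _).trans hn)
  have h2 := hM n ((le_max_right _ _).trans hn) n ((le_max_right _ _).trans hn)
  rw [gromovProduct_comm] at h2
  have := hδ.le_of_le h1 h2
  linarith

/-- For large `n`, two uses of hyperbolicity along `σ t`, `σ n`, `τ n`, `τ t` give `(σ t|τ t) ≥ t -
C - 2 * δ`. The distances from `o` to `σ t` and `τ t` add up to at most `2 * t + C`, so the rays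
stay within `3 * C + 4 * δ`. -/
lemma eq_of_boundaryProduct_eq_top {δ : ℝ} (hδ : HyperbolicWith X δ) (h0 : 0 ≤ δ) {o : X}
    {ξ η : HyperbolicBoundary X} (h : boundaryProduct o ξ η = ⊤) : ξ = η := by
  obtain ⟨σ, rfl⟩ := GeodesicRay.exists_endpoint_eq ξ
  obtain ⟨τ, rfl⟩ := GeodesicRay.exists_endpoint_eq η
  set C := dist o (σ.1 ⟨0, Set.mem_Ici.2 le_rfl⟩) + dist o (τ.1 ⟨0, Set.mem_Ici.2 le_rfl⟩)
  have hC : 0 ≤ dist o (σ.1 ⟨0, Set.mem_Ici.2 le_rfl⟩) := dist_nonneg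
  have hC' : 0 ≤ dist o (τ.1 ⟨0, Set.mem_Ici.2 le_rfl⟩) := dist_nonneg
  refine Quotient.sound ⟨3 * C + 4 * δ, fun t => ?_⟩
  have h1 := lt_gromovProduct_of_lt_boundaryProduct (σ.convergesToBoundary o)
    (τ.convergesToBoundary o) (h.symm ▸ ENNReal.ofReal_lt_top (r := t))
  obtain ⟨N, hN⟩ := exists_nat_ge (t : ℝ)
  obtain ⟨n, hn, hNn⟩ := (h1.and (eventually_ge_atTop N)).exists
  have htn : (t : ℝ) ≤ n := hN.trans (Nat.cast_le.2 hNn)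
  have hσ := σ.min_sub_le_gromovProduct o t ⟨n, Set.mem_Ici.2 (Nat.cast_nonneg _)⟩
  have hτ := τ.min_sub_le_gromovProduct o ⟨n, Set.mem_Ici.2 (Nat.cast_nonneg _)⟩ t
  simp only [min_eq_left htn, min_eq_right htn] at hσ hτ
  have h2 : (t : ℝ) - C - δ ≤ gromovProduct o (σ.1 t) (τ.point n) :=
    hδ.le_of_le (y := σ.point n) (by simp only [GeodesicRay.point]; linarith) (by linarith)
  have h3 : (t : ℝ) - C - δ - δ ≤ gromovProduct o (σ.1 t) (τ.1 t) :=
    hδ.le_of_le (y := τ.point n) h2 (by simp only [GeodesicRay.point]; linarith)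
  have h4 := σ.dist_le_add o t
  have h5 := τ.dist_le_add o t
  simp only [gromovProduct] at h3
  linarith

/-- Since the boundary product is an infimum, the outer sequences are arbitrary, and the points of
one ray to `η` serve as the middle sequence; no constant beyond `δ` is lost. -/
lemma boundaryProduct_le_add {δ : ℝ} (hδ : HyperbolicWith X δ) (h0 : 0 ≤ δ) (o : X)
    (ξ η ζ : HyperbolicBoundary X) :
    min (boundaryProduct o ξ η) (boundaryProduct o η ζ) ≤
      boundaryProduct o ξ ζ + ENNReal.ofReal δ := by
  obtain ⟨σ, rfl⟩ := GeodesicRay.exists_endpoint_eq η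
  rw [← tsub_le_iff_right]
  refine le_boundaryProduct fun x z hx hz r hr h => ?_
  rw [lt_tsub_iff_right, ← ENNReal.ofReal_add hr h0, lt_min_iff] at h
  filter_upwards [lt_gromovProduct_of_lt_boundaryProduct hx (σ.convergesToBoundary o)
    h.1, lt_gromovProduct_of_lt_boundaryProduct (σ.convergesToBoundary o) hz
    h.2] with n h1 h2
  have := hδ.le_of_le h1.le h2.le
  linarith

/-- A small infimum only controls some pair of sequences. Comparing these with the ray points uses
hyperbolicity twice, whence `2 * δ`. -/
lemma gromovProduct_lt_of_boundaryProduct_lt {δ : ℝ} (hδ : HyperbolicWith X δ) (h0 : 0 ≤ δ) {o : X}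
    {σ τ : GeodesicRay X} {r : ℝ} (h : boundaryProduct o σ.endpoint τ.endpoint < ENNReal.ofReal r) :
    ∀ᶠ n in atTop, gromovProduct o (σ.point n) (τ.point n) < r + 2 * δ := by
  simp only [boundaryProduct, iInf_lt_iff] at h
  obtain ⟨x, y, hx, hy, h⟩ := h
  obtain ⟨N, hN⟩ := GeodesicRay.exists_le_gromovProduct hx (r + 2 * δ)
  obtain ⟨M, hM⟩ := GeodesicRay.exists_le_gromovProduct hy (r + 2 * δ)
  -- The liminf bounds the product only for infinitely many `n`; one such `n` beyond both thresholds
  -- is enough.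
  obtain ⟨n, hn, hn'⟩ := ((frequently_lt_of_liminf_lt (by isBoundedDefault) h).and_eventually
    (eventually_ge_atTop (max N M))).exists
  have hn := (ENNReal.ofReal_lt_ofReal_iff'.1 hn).1
  filter_upwards [eventually_ge_atTop (max N M)] with m hm
  by_contra! hc
  have h1 := hN n ((le_max_left _ _).trans hn') m ((le_max_left _ _).trans hm)
  have h2 := hM n ((le_max_right _ _).trans hn') m ((le_max_right _ _).trans hm)
  rw [gromovProduct_comm] at h2
  have h3 := hδ.le_of_le h1 hc
  have h4 : r + 2 * δ - δ - δ ≤ gromovProduct o (x n) (y n) :=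
    hδ.le_of_le h3 (by linarith)
  linarith

/-! ### Visual metrics -/

lemma visualKernel_nonneg {o : X} {a : ℝ} (ha : 1 < a) (ξ η : HyperbolicBoundary X) :
    0 ≤ visualKernel o a ξ η := by
  unfold visualKernel
  split_ifs
  · exact le_rfl
  · positivity

lemma visualKernel_comm (o : X) (a : ℝ) (ξ η : HyperbolicBoundary X) :
    visualKernel o a ξ η = visualKernel o a η ξ := by
  simp only [visualKernel, boundaryProduct_comm o ξ η]

lemma visualKernel_le_of_boundaryProduct_le {o : X} {a : ℝ} (ha : 1 < a) {δ : ℝ} (h0 : 0 ≤ δ)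
    {ξ η ξ' η' : HyperbolicBoundary X}
    (h : boundaryProduct o ξ η ≤ boundaryProduct o ξ' η' + ENNReal.ofReal δ) :
    visualKernel o a ξ' η' ≤ a ^ δ * visualKernel o a ξ η := by
  by_cases h1 : boundaryProduct o ξ' η' = ⊤
  · rw [visualKernel, if_pos h1]
    have := visualKernel_nonneg (o := o) ha ξ η
    positivity
  · have h2 : boundaryProduct o ξ η ≠ ⊤ := fun h2 => by
      rw [h2, top_le_iff, ENNReal.add_eq_top] at h
      exact h.elim h1 ENNReal.ofReal_ne_top
    rw [visualKernel, visualKernel, if_neg h1, if_neg h2, ← Real.rpow_add (by linarith)]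
    refine Real.rpow_le_rpow_of_exponent_le ha.le ?_
    have h3 := ENNReal.toReal_mono (ENNReal.add_ne_top.2 ⟨h1, ENNReal.ofReal_ne_top⟩) h
    rw [ENNReal.toReal_add h1 ENNReal.ofReal_ne_top, ENNReal.toReal_ofReal h0] at h3
    linarith

lemma visualKernel_le_max {δ : ℝ} (hδ : HyperbolicWith X δ) (h0 : 0 ≤ δ) (o : X) {a : ℝ}
    (ha : 1 < a) (ξ η ζ : HyperbolicBoundary X) :
    visualKernel o a ξ ζ ≤ a ^ δ * max (visualKernel o a ξ η) (visualKernel o a η ζ) := by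
  have h := boundaryProduct_le_add hδ h0 o ξ η ζ
  have hp : 0 ≤ a ^ δ := by positivity
  rcases min_le_iff.1 h with h | h
  · exact (visualKernel_le_of_boundaryProduct_le ha h0 h).trans
      (mul_le_mul_of_nonneg_left (le_max_left _ _) hp)
  · exact (visualKernel_le_of_boundaryProduct_le ha h0 h).trans
      (mul_le_mul_of_nonneg_left (le_max_right _ _) hp)

/-- `PseudoMetricSpace.ofPreNNDist` is the infimum of the `ρ`-lengths of chains. Frink's lemma
compares it with `ρ` under a four-point inequality with constant 2, which two uses of
`visualKernel_le_max` provide. -/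
lemma exists_isVisualMetric {δ : ℝ} (hδ : HyperbolicWith X δ) (h0 : 0 ≤ δ) (o : X) {a : ℝ}
    (ha : 1 < a) (ha2 : a ^ δ * a ^ δ ≤ 2) :
    ∃ d : MetricSpace (HyperbolicBoundary X), IsVisualMetric o a d := by
  let ρ : HyperbolicBoundary X → HyperbolicBoundary X → NNReal :=
    fun ξ η => ⟨visualKernel o a ξ η, visualKernel_nonneg ha ξ η⟩
  have hself : ∀ ξ, ρ ξ ξ = 0 := fun ξ =>
    NNReal.eq (if_pos (boundaryProduct_self hδ o ξ))
  have hcomm : ∀ ξ η, ρ ξ η = ρ η ξ := fun ξ η => NNReal.eq (visualKernel_comm o a ξ η)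
  have hfour : ∀ ξ₁ ξ₂ ξ₃ ξ₄, ρ ξ₁ ξ₄ ≤ 2 * max (ρ ξ₁ ξ₂) (max (ρ ξ₂ ξ₃) (ρ ξ₃ ξ₄)) := by
    intro ξ₁ ξ₂ ξ₃ ξ₄
    have h1 := visualKernel_le_max hδ h0 o ha ξ₁ ξ₂ ξ₄
    have h2 := visualKernel_le_max hδ h0 o ha ξ₂ ξ₃ ξ₄
    have hB : 1 ≤ a ^ δ := Real.one_le_rpow ha.le h0
    have h12 := visualKernel_nonneg (o := o) ha ξ₁ ξ₂
    rw [← NNReal.coe_le_coe]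
    push_cast
    change visualKernel o a ξ₁ ξ₄ ≤ 2 * max (visualKernel o a ξ₁ ξ₂)
      (max (visualKernel o a ξ₂ ξ₃) (visualKernel o a ξ₃ ξ₄))
    set m := max (visualKernel o a ξ₂ ξ₃) (visualKernel o a ξ₃ ξ₄)
    set M := max (visualKernel o a ξ₁ ξ₂) m
    have hM : 0 ≤ M := h12.trans (le_max_left _ _)
    have h3 : max (visualKernel o a ξ₁ ξ₂) (visualKernel o a ξ₂ ξ₄) ≤ a ^ δ * M :=
      max_le ((le_max_left _ _).trans (le_mul_of_one_le_left hM hB))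
        (h2.trans (mul_le_mul_of_nonneg_left (le_max_right _ _) (by linarith)))
    calc _ ≤ a ^ δ * (a ^ δ * M) := h1.trans (mul_le_mul_of_nonneg_left h3 (by linarith))
      _ = a ^ δ * a ^ δ * M := by ring
      _ ≤ 2 * M := mul_le_mul_of_nonneg_right ha2 hM
  have hle := PseudoMetricSpace.dist_ofPreNNDist_le ρ hself hcomm
  have hge := PseudoMetricSpace.le_two_mul_dist_ofPreNNDist ρ hself hcomm hfour
  let d : MetricSpace (HyperbolicBoundary X) :=
    { PseudoMetricSpace.ofPreNNDist ρ hself hcomm with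
      eq_of_dist_eq_zero := by
        intro ξ η h
        have h1 := hge ξ η
        rw [show @dist _ (PseudoMetricSpace.ofPreNNDist ρ hself hcomm).toDist ξ η = 0 from h,
          mul_zero] at h1
        by_contra hne
        have h2 : boundaryProduct o ξ η ≠ ⊤ := fun h => hne (eq_of_boundaryProduct_eq_top hδ h0 h)
        have h3 : (ρ ξ η : ℝ) = a ^ (-(boundaryProduct o ξ η).toReal) := if_neg h2
        have : 0 < a ^ (-(boundaryProduct o ξ η).toReal) := by positivity
        linarith }
  refine ⟨d, 2, two_pos, fun ξ η => ⟨?_, ?_⟩⟩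
  · have := hge ξ η
    change _ ≤ @dist _ (PseudoMetricSpace.ofPreNNDist ρ hself hcomm).toDist ξ η
    change visualKernel o a ξ η ≤ _ at this
    linarith
  · have h1 := hle ξ η
    have h2 := visualKernel_nonneg (o := o) ha ξ η
    change @dist _ (PseudoMetricSpace.ofPreNNDist ρ hself hcomm).toDist ξ η ≤ _
    change _ ≤ visualKernel o a ξ η at h1
    linarith

end Hyperbolic

/-! ### Finite multiplicity -/

lemma exists_maximal_separated {Y : Type*} (d : MetricSpace Y) {ε : ℝ} (hε : 0 < ε) :
    ∃ A : Set Y, (∀ x ∈ A, ∀ y ∈ A, x ≠ y → ε ≤ dist x y) ∧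
      (⋃ c ∈ A, Metric.ball c ε) = Set.univ := by
  obtain ⟨A, hA⟩ := zorn_subset {A : Set Y | A.Pairwise fun x y => ε ≤ dist x y}
    fun c hc hchain => ⟨⋃₀ c, (Set.pairwise_sUnion hchain.directedOn).2 fun s hs => hc hs,
      fun s hs => Set.subset_sUnion_of_mem hs⟩
  refine ⟨A, fun x hx y hy h => hA.prop hx hy h, Set.eq_univ_of_forall fun y => ?_⟩
  simp only [Set.mem_iUnion, Metric.mem_ball, exists_prop]
  by_contra! h
  have hins : (insert y A).Pairwise fun x y => ε ≤ dist x y :=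
    hA.prop.insert fun b hb _ => ⟨h b hb, by rw [dist_comm]; exact h b hb⟩
  have hy : y ∈ A := hA.le_of_ge hins (Set.subset_insert y A) (Set.mem_insert y A)
  have := h y hy
  rw [dist_self] at this
  linarith

/-- Reduces the count of centres to finite families, for which one index `n` can be chosen far out
on all rays at once. -/
lemma encard_le_of_forall_finset {Y : Type*} {s : Set Y} {N : ℕ}
    (h : ∀ F : Finset Y, (F : Set Y) ⊆ s → F.card ≤ N) : s.encard ≤ N := by
  by_contra! hlt
  obtain ⟨t, ht, hc⟩ := Set.exists_subset_encard_eq (Order.add_one_le_of_lt hlt)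
  have hfin : t.Finite := Set.finite_of_encard_eq_coe (k := N + 1) (by simpa using hc)
  have h1 := h hfin.toFinset (by simpa using ht)
  rw [hfin.encard_eq_coe_toFinset_card] at hc
  have : hfin.toFinset.card = N + 1 := by exact_mod_cast hc
  omega

section Hyperbolic

variable {X : Type*} [MetricSpace X]

/-- Any two points of the space are joined by an approximate geodesic in `P`. -/
def IsRoughlyGeodesic (P : Set X) (C : ℝ) : Prop :=
  ∀ (x y : X) (T : ℝ), 0 ≤ T → T + C ≤ dist x y →
    ∃ p ∈ P, dist x p ≤ T + C ∧ dist p y ≤ dist x y - T + C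

/-- The number of points of `P` in a ball centred at a point of `P` is bounded in terms of the
radius of the ball. -/
def HasBoundedGeometry (P : Set X) : Prop :=
  ∀ M : ℝ, ∃ N : ℕ, ∀ p ∈ P, {q ∈ P | dist p q ≤ M}.encard ≤ N

/-- `N` is chosen before `R`: the vertices `p ξ` lie in a ball whose radius does not involve `R`,
and `ξ ↦ p ξ` is injective on `F`. -/
lemma card_le_of_boundaryProduct_bounds {δ : ℝ} (hδ : HyperbolicWith X δ) (h0 : 0 ≤ δ)
    {P : Set X} {C : ℝ} (hC : 0 ≤ C) (hP : IsRoughlyGeodesic P C) (hP' : HasBoundedGeometry P)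
    (o : X) {L : ℝ} (hL : 0 ≤ L) :
    ∃ N : ℕ, ∀ R : ℝ, 0 ≤ R → ∀ (η : HyperbolicBoundary X) (F : Finset (HyperbolicBoundary X)),
      (∀ ξ ∈ F, ENNReal.ofReal R < boundaryProduct o ξ η) →
      (∀ ξ ∈ F, ∀ ξ' ∈ F, ξ ≠ ξ' → boundaryProduct o ξ ξ' < ENNReal.ofReal (R + L)) →
      F.card ≤ N := by
  classical
  obtain ⟨N, hN⟩ := hP' (2 * L + 4 * C + 12 * δ)
  refine ⟨N, fun R hR η F h1 h2 => ?_⟩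
  rcases F.eq_empty_or_nonempty with rfl | ⟨ξ₀, hξ₀⟩
  · simp
  choose σ hσ using GeodesicRay.exists_endpoint_eq (X := X)
  have hconv : ∀ ξ, ConvergesToBoundary o (σ ξ).point ξ := fun ξ => by
    have := (σ ξ).convergesToBoundary o
    rwa [hσ] at this
  -- Chosen so that `T - C - δ = R + L + 2 * δ`, the bound that `e2` forbids.
  set T := R + L + C + 3 * δ with hT
  have e1 : ∀ᶠ n in atTop, ∀ ξ ∈ F, R < gromovProduct o ((σ ξ).point n) ((σ η).point n) :=
    (eventually_all_finset F).2 fun ξ hξ =>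
      lt_gromovProduct_of_lt_boundaryProduct (hconv ξ) (hconv η) (h1 ξ hξ)
  have e2 : ∀ᶠ n in atTop, ∀ ξ ∈ F, ∀ ξ' ∈ F, ξ ≠ ξ' →
      gromovProduct o ((σ ξ).point n) ((σ ξ').point n) < R + L + 2 * δ := by
    refine (eventually_all_finset F).2 fun ξ hξ => (eventually_all_finset F).2 fun ξ' hξ' => ?_
    by_cases hne : ξ = ξ'
    · exact Eventually.of_forall fun n h => absurd hne h
    · have h3 := h2 ξ hξ ξ' hξ' hne
      rw [← hσ ξ, ← hσ ξ'] at h3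
      exact (gromovProduct_lt_of_boundaryProduct_lt hδ h0 h3).mono fun n hn _ => hn
  have e3 : ∀ᶠ n in atTop, ∀ ξ ∈ F, T + C ≤ dist o ((σ ξ).point n) := by
    refine (eventually_all_finset F).2 fun ξ _ => ?_
    obtain ⟨M, hM⟩ := exists_nat_ge (T + C + dist o ((σ ξ).1 ⟨0, Set.mem_Ici.2 le_rfl⟩))
    filter_upwards [eventually_ge_atTop M] with n hn
    have h3 := (σ ξ).sub_le_dist o ⟨n, Set.mem_Ici.2 (Nat.cast_nonneg _)⟩
    have h4 : (M : ℝ) ≤ n := Nat.cast_le.2 hn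
    simp only [GeodesicRay.point] at h3 ⊢
    linarith
  obtain ⟨n, f1, f2, f3⟩ := (e1.and (e2.and e3)).exists
  set x : HyperbolicBoundary X → X := fun ξ => (σ ξ).point n
  have hp : ∀ ξ, ∃ p, ξ ∈ F → p ∈ P ∧ dist o p ≤ T + C ∧ dist p (x ξ) ≤ dist o (x ξ) - T + C := by
    intro ξ
    by_cases hξ : ξ ∈ F
    · obtain ⟨p, hp⟩ := hP o (x ξ) T (by positivity) (f3 ξ hξ)
      exact ⟨p, fun _ => hp⟩
    -- Outside `F` the value of `p` is irrelevant.
    · exact ⟨o, fun h => absurd h hξ⟩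
  choose p hp using hp
  have hpx : ∀ ξ ∈ F, T - C ≤ gromovProduct o (p ξ) (x ξ) := by
    intro ξ hξ
    obtain ⟨-, -, h4⟩ := hp ξ hξ
    have := dist_triangle o (p ξ) (x ξ)
    rw [gromovProduct]
    linarith
  -- A common vertex would force `(x ξ|x ξ') ≥ T - C - δ`.
  have hinj : Set.InjOn p F := by
    intro ξ hξ ξ' hξ' heq
    by_contra hne
    have h3 := hpx ξ hξ
    have h4 := hpx ξ' hξ'
    rw [← heq] at h4
    rw [gromovProduct_comm] at h3
    have h5 := hδ.le_of_le h3 h4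
    have h6 := f2 ξ hξ ξ' hξ' hne
    linarith
  -- The product of the two vertices is at least `R - 3 * δ` and their heights are at most `T + C`;
  -- the bound is `2 * (T + C) - 2 * (R - 3 * δ)`.
  have hdist : ∀ ξ ∈ F, ∀ ξ' ∈ F, dist (p ξ) (p ξ') ≤ 2 * L + 4 * C + 12 * δ := by
    intro ξ hξ ξ' hξ'
    have h3 : R - δ ≤ gromovProduct o (x ξ) (x ξ') :=
      hδ.le_of_le (f1 ξ hξ).le (by rw [gromovProduct_comm]; exact (f1 ξ' hξ').le)
    have h4 : R - δ - δ ≤ gromovProduct o (p ξ) (x ξ') :=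
      hδ.le_of_le (by linarith [hpx ξ hξ]) h3
    have h5 : R - δ - δ - δ ≤ gromovProduct o (p ξ) (p ξ') :=
      hδ.le_of_le h4 (by rw [gromovProduct_comm]; linarith [hpx ξ' hξ'])
    obtain ⟨-, h6, -⟩ := hp ξ hξ
    obtain ⟨-, h7, -⟩ := hp ξ' hξ'
    rw [gromovProduct] at h5
    linarith
  have hsub : ((F.image p : Finset X) : Set X) ⊆
      {q ∈ P | dist (p ξ₀) q ≤ 2 * L + 4 * C + 12 * δ} := by
    intro q hq
    obtain ⟨ξ, hξ, rfl⟩ := Finset.mem_image.1 (Finset.mem_coe.1 hq)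
    exact ⟨(hp ξ hξ).1, hdist ξ₀ hξ₀ ξ hξ⟩
  have h3 := (Set.encard_le_encard hsub).trans (hN (p ξ₀) (hp ξ₀ hξ₀).1)
  rw [Set.encard_coe_eq_coe_finsetCard, Finset.card_image_of_injOn hinj] at h3
  exact_mod_cast h3

lemma ofReal_lt_boundaryProduct_of_visualKernel_lt {o : X} {a : ℝ} (ha : 1 < a)
    {ξ η : HyperbolicBoundary X} {R : ℝ} (hR : 0 ≤ R) (h : visualKernel o a ξ η < a ^ (-R)) :
    ENNReal.ofReal R < boundaryProduct o ξ η := by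
  by_cases htop : boundaryProduct o ξ η = ⊤
  · rw [htop]; exact ENNReal.ofReal_lt_top
  · rw [visualKernel, if_neg htop, Real.rpow_lt_rpow_left_iff ha] at h
    rw [ENNReal.ofReal_lt_iff_lt_toReal hR htop]
    linarith

lemma boundaryProduct_lt_ofReal_of_lt_visualKernel {o : X} {a : ℝ} (ha : 1 < a)
    {ξ η : HyperbolicBoundary X} {R : ℝ} (h : a ^ (-R) < visualKernel o a ξ η) :
    boundaryProduct o ξ η < ENNReal.ofReal R := by
  by_cases htop : boundaryProduct o ξ η = ⊤
  · rw [visualKernel, if_pos htop] at h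
    have : 0 < a ^ (-R) := by positivity
    linarith
  · rw [visualKernel, if_neg htop, Real.rpow_lt_rpow_left_iff ha] at h
    rw [ENNReal.lt_ofReal_iff_toReal_lt htop]
    linarith

theorem IsVisualMetric.hasFiniteMultiplicity {δ : ℝ} (hδ : HyperbolicWith X δ) (h0 : 0 ≤ δ)
    {P : Set X} {C : ℝ} (hC : 0 ≤ C) (hP : IsRoughlyGeodesic P C) (hP' : HasBoundedGeometry P)
    {o : X} {a : ℝ} (ha : 1 < a) (d : MetricSpace (HyperbolicBoundary X))
    (hd : IsVisualMetric o a d) : HasFiniteMultiplicity d := by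
  obtain ⟨c, hc, hvis⟩ := hd
  have ha0 : 0 < a := by linarith
  set l := Real.logb a c
  have hl : a ^ l = c := Real.rpow_logb ha0 ha.ne' hc
  -- The lower and upper visual bounds each shift the exponent by `l`; the extra 1 makes the
  -- inequality strict.
  obtain ⟨N, hN⟩ := card_le_of_boundaryProduct_bounds hδ h0 hC hP hP' o
    (L := 2 * |l| + 1) (by positivity)
  -- The condition `ε < c⁻¹` ensures that the height `R = r - l` is nonnegative.
  refine ⟨N + 1, N.succ_pos, c⁻¹, inv_pos.2 hc, fun ε hε hε' => ?_⟩
  obtain ⟨A, hA, hcov⟩ := exists_maximal_separated d hε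
  refine ⟨A, hcov, fun η => ?_⟩
  set r := -Real.logb a ε
  have hr : a ^ (-r) = ε := by rw [neg_neg]; exact Real.rpow_logb ha0 ha.ne' hε
  have hlr : 0 ≤ r - l := by
    have h1 : a ^ (-r) < a ^ (-l) := by rwa [hr, Real.rpow_neg ha0.le, hl]
    rw [Real.rpow_lt_rpow_left_iff ha] at h1
    linarith
  refine (encard_le_of_forall_finset fun F hF => hN (r - l) hlr η F ?_ ?_).trans
    (Nat.cast_le.2 N.le_succ)
  · intro ξ hξ
    refine ofReal_lt_boundaryProduct_of_visualKernel_lt ha hlr ?_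
    have h1 : dist η ξ < ε := (hF hξ).2
    have h2 := (hvis ξ η).1
    rw [dist_comm, inv_mul_le_iff₀ hc] at h2
    rw [show -(r - l) = l + -r by ring, Real.rpow_add ha0, hl, hr]
    exact h2.trans_lt (mul_lt_mul_of_pos_left h1 hc)
  · intro ξ hξ ξ' hξ' hne
    refine boundaryProduct_lt_ofReal_of_lt_visualKernel ha ?_
    have h1 := (hA ξ (hF hξ).1 ξ' (hF hξ').1 hne).trans (hvis ξ ξ').2
    have h2 : a ^ (-r - l) ≤ visualKernel o a ξ ξ' := by
      rw [Real.rpow_sub ha0, hl, hr, div_le_iff₀' hc]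
      exact h1
    refine lt_of_lt_of_le (Real.rpow_lt_rpow_of_exponent_lt ha ?_) h2
    linarith [le_abs_self l]

end Hyperbolic

/-! ### The vertices of a metric graph -/

namespace MetricGraph

variable {V : Type*} {Γ : SimpleGraph V} (hΓ : Γ.Connected)

/-- The point of the realization which corresponds to a vertex. -/
noncomputable def vertex (a : V) : MetricGraph Γ hΓ :=
  ⟨Finsupp.single a 1, a, a, Or.inl rfl, left_mem_segment _ _ _⟩

/-- Between vertices there is only one outer length, and an inner length is never shorter than an
outer one. -/
lemma dist_vertex (a b : V) : dist (vertex hΓ a) (vertex hΓ b) = Γ.dist a b := by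
  classical
  have hout : ∀ r, OuterLength Γ (vertex hΓ a).1 (vertex hΓ b).1 r ↔ r = Γ.dist a b := by
    intro r
    constructor
    · rintro ⟨a', b', ha, hb, rfl⟩
      obtain rfl : a = a' := by
        by_contra h
        exact ha (by simp [vertex, h])
      obtain rfl : b = b' := by
        by_contra h
        exact hb (by simp [vertex, h])
      simp [vertex]
    · rintro rfl
      exact ⟨a, b, by simp [vertex], by simp [vertex], by simp [vertex]⟩
  refine le_antisymm (dist_le_length _ _ (Or.inr ((hout _).2 rfl))) ?_
  rcases dist_mem (vertex hΓ a) (vertex hΓ b) with h | h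
  · obtain ⟨t, ht, hle⟩ := inner_of_vertex h (w := b) (by simp [vertex])
    rwa [(hout t).1 ht] at hle
  · exact ((hout _).1 h).ge

lemma exists_dist_vertex_le_one (x : MetricGraph Γ hΓ) : ∃ a, dist x (vertex hΓ a) ≤ 1 := by
  obtain ⟨a, ha⟩ := exists_ne_zero x
  refine ⟨a, (dist_le_length _ _ (Or.inr ⟨a, a, ha, by simp [vertex], rfl⟩)).trans ?_⟩
  obtain ⟨u, v, -, hx⟩ := x.2
  have := ((edge_cases hx).1 a).1
  simp [vertex, this]

/-- Follow a shortest edge path between vertices near `x` and `y` for `⌊T⌋₊` steps. The errors from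
moving to vertices and rounding `T` total at most 4, so 5 suffices. -/
lemma isRoughlyGeodesic_range_vertex : IsRoughlyGeodesic (Set.range (vertex hΓ)) 5 := by
  intro x y T hT hxy
  obtain ⟨a, ha⟩ := exists_dist_vertex_le_one hΓ x
  obtain ⟨b, hb⟩ := exists_dist_vertex_le_one hΓ y
  have hab := dist_vertex hΓ a b
  have h1 := dist_triangle4 x (vertex hΓ a) (vertex hΓ b) y
  have h2 := dist_triangle4 (vertex hΓ a) x y (vertex hΓ b)
  rw [dist_comm (vertex hΓ b) y] at h1
  rw [dist_comm (vertex hΓ a) x] at h2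
  have hk := Nat.floor_le hT
  have hk' := Nat.lt_floor_add_one T
  set k := ⌊T⌋₊
  obtain ⟨w, hw⟩ := hΓ.exists_walk_length_eq_dist a b
  have hkD : k ≤ Γ.dist a b := by
    have : (k : ℝ) ≤ Γ.dist a b := by linarith
    exact_mod_cast this
  have h3 : Γ.dist a (w.getVert k) ≤ k :=
    (SimpleGraph.dist_le (w.take k)).trans (by simp)
  have h4 : Γ.dist (w.getVert k) b + k ≤ Γ.dist a b := by
    have := SimpleGraph.dist_le (w.drop k)
    simp only [SimpleGraph.Walk.drop_length] at this
    omega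
  have h3' : (Γ.dist a (w.getVert k) : ℝ) ≤ k := by exact_mod_cast h3
  have h4' : (Γ.dist (w.getVert k) b : ℝ) + k ≤ Γ.dist a b := by exact_mod_cast h4
  refine ⟨_, ⟨w.getVert k, rfl⟩, ?_, ?_⟩
  · have := dist_triangle x (vertex hΓ a) (vertex hΓ (w.getVert k))
    rw [dist_vertex] at this
    linarith
  · have := dist_triangle (vertex hΓ (w.getVert k)) (vertex hΓ b) y
    rw [dist_vertex, dist_comm (vertex hΓ b) y] at this
    linarith

end MetricGraph

/-! ### Balls in Cayley graphs -/

section Cayley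

open scoped Pointwise

variable {G : Type*} [Group G] {S : Set G}

/-- Each edge is right multiplication by an element of `S ∪ S⁻¹`. Including 1 makes the powers
increasing, so shorter walks are covered too. -/
lemma inv_mul_mem_pow_length {g h : G} (w : (SimpleGraph.mulCayley S).Walk g h) :
    g⁻¹ * h ∈ (insert 1 (S ∪ S⁻¹) : Set G) ^ w.length := by
  induction w with
  | nil => simp
  | @cons u v w hadj p ih =>
    rw [SimpleGraph.Walk.length_cons, pow_succ']
    refine ⟨u⁻¹ * v, Or.inr ?_, v⁻¹ * w, ih, by group⟩
    refine ((SimpleGraph.mulCayley_adj S u v).1 hadj).2.imp id fun h => ?_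
    rw [Set.mem_inv, mul_inv_rev, inv_inv]
    exact h

lemma finite_pow {s : Set G} (hs : s.Finite) (n : ℕ) : (s ^ n).Finite := by
  induction n with
  | zero => simp
  | succ n ih => rw [pow_succ]; exact ih.mul hs

/-- The vertices within `M` of `g` lie in the left translate by `g` of one finite set, so the bound
does not depend on `g`. -/
lemma hasBoundedGeometry_range_vertex (hfin : S.Finite) (hgen : Subgroup.closure S = ⊤) :
    HasBoundedGeometry (Set.range (MetricGraph.vertex (mulCayley_connected hgen))) := by
  intro M
  set hΓ := mulCayley_connected hgen
  set U : Set G := insert 1 (S ∪ S⁻¹)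
  have hU : (U ^ ⌊M⌋₊).Finite := finite_pow ((hfin.union hfin.inv).insert 1) _
  refine ⟨(U ^ ⌊M⌋₊).ncard, ?_⟩
  rintro _ ⟨g, rfl⟩
  have hsub : {q ∈ Set.range (MetricGraph.vertex hΓ) | dist (MetricGraph.vertex hΓ g) q ≤ M} ⊆
      (fun u => MetricGraph.vertex hΓ (g * u)) '' (U ^ ⌊M⌋₊) := by
    rintro _ ⟨⟨h, rfl⟩, hM⟩
    rw [MetricGraph.dist_vertex] at hM
    obtain ⟨w, hw⟩ := hΓ.exists_walk_length_eq_dist g h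
    refine ⟨g⁻¹ * h, ?_, by simp⟩
    refine Set.pow_subset_pow_right (Set.mem_insert 1 _) ?_ (inv_mul_mem_pow_length w)
    rw [hw]
    exact Nat.le_floor hM
  refine (Set.encard_le_encard hsub).trans ((Set.encard_image_le _ _).trans ?_)
  rw [hU.cast_ncard_eq]

end Cayley

theorem mainTheorem5 {G : Type*} [Group G] (S : Set G) (hfin : S.Finite)
    (hgen : Subgroup.closure S = ⊤) (hyp : IsGromovHyperbolic (CayleyGraph S hgen))
    (o : CayleyGraph S hgen) :
    (∃ a₀ : ℝ, 1 < a₀ ∧ ∀ a : ℝ, 1 < a → a < a₀ →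
      ∃ d : MetricSpace (HyperbolicBoundary (CayleyGraph S hgen)), IsVisualMetric o a d) ∧
    ∀ a : ℝ, 1 < a → ∀ d : MetricSpace (HyperbolicBoundary (CayleyGraph S hgen)),
      IsVisualMetric o a d → HasFiniteMultiplicity d := by
  obtain ⟨δ, h0, hδ⟩ := hyp.exists_nonneg
  have hδ' : 0 < 2 * δ + 1 := by linarith
  -- This `a₀` gives `a ^ (2 * δ) ≤ a ^ (2 * δ + 1) ≤ 2`; the `+ 1` covers `δ = 0`.
  refine ⟨⟨2 ^ (2 * δ + 1)⁻¹, Real.one_lt_rpow one_lt_two (inv_pos.2 hδ'), fun a ha ha' => ?_⟩,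
    fun a ha d hd => hd.hasFiniteMultiplicity hδ h0 (by norm_num)
      (MetricGraph.isRoughlyGeodesic_range_vertex _)
      (hasBoundedGeometry_range_vertex hfin hgen) ha d⟩
  refine exists_isVisualMetric hδ h0 o ha ?_
  have ha0 : 0 < a := by linarith
  rw [← Real.rpow_add ha0]
  calc a ^ (δ + δ) ≤ a ^ (2 * δ + 1) := Real.rpow_le_rpow_of_exponent_le ha.le (by linarith)
    _ ≤ (2 ^ (2 * δ + 1)⁻¹) ^ (2 * δ + 1) := Real.rpow_le_rpow ha0.le ha'.le hδ'.le
    _ = 2 := Real.rpow_inv_rpow zero_le_two hδ'.ne'
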